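/- All graphs are finite and simple. For a connected graph $G$, a set $S\subseteq E(G)$ is called an anti-Kekulé set of $G$ if $G-S$ (the graph obtained from $G$ by deleting the edges in $S$ and keeping all vertices) is connected and has no perfect matching. Let $\mathcal{G}$ be the family of graphs, considered up to isomorphism, defined recursively as follows. (a) $K_2$ and all cycles of even length (at least $4$) belong to $\mathcal{G}$. (b) Let $H$ be a connected graph with vertex set $\{u_1,\dots,u_p\}$, $p\ge 2$, and let $F_1,\dots,F_p\in\mathcal{G}$, where $H,F_1,\dots,F_p$ are pairwise vertex-disjoint. For each $i$ choose a vertex $v_i\in V(F_i)$. Then the graph $H[F_1(u_1v_1),\dots,F_p(u_pv_p)]$ obtained from $H,F_1,\dots,F_p$ by identifying $u_i$ with $v_i$ for each $i$ belongs to $\mathcal{G}$. Only graphs obtained in this way belong to $\mathcal{G}$. **Theorem 1.1.** Let $G$ be a connected graph. The following statements are equivalent: (1) $G$ has no anti-Kekulé set; (2) every connected spanning subgraph of $G$ has a perfect matching; (3) every spanning tree of $G$ has a perfect matching; (4) $G\in\mathcal{G}$. -/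

import Mathlib

namespace AntiKekule

universe u

/-- `G` has a perfect matching. -/
def HasPerfectMatching {V : Type u} (G : SimpleGraph V) : Prop :=
  ∃ M : G.Subgraph, M.IsPerfectMatching

/-- A set `S` of edges of `G` is an anti-Kekulé set of `G` if `G - S` is connected and has no
perfect matching. -/
def IsAntiKekuleSet {V : Type u} (G : SimpleGraph V) (S : Set (Sym2 V)) : Prop :=
  S ⊆ G.edgeSet ∧ (G.deleteEdges S).Connected ∧ ¬ HasPerfectMatching (G.deleteEdges S)

/-- The embedding sending the vertex `i` of `H` to the vertex `v i` of the `i`-th summand. -/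
def rootEmbedding {ι : Type u} {W : ι → Type u} (v : ∀ i, W i) : ι ↪ (Σ i, W i) :=
  ⟨fun i => ⟨i, v i⟩, fun _ _ h => congrArg Sigma.fst h⟩

/-- The graph `H[F_1(u_1 v_1), …, F_p(u_p v_p)]`: the vertices of `H` are the elements `i : ι`,
and vertex `i` of `H` is identified with the vertex `v i` of `F i`. As every vertex of `H` is
identified with exactly one vertex of the disjoint union of the `F i`, the vertex set of the result
is that disjoint union, and the graph is the union of the copies of the `F i` and of the copy
of `H` on the vertices `v i`. -/
def identify {ι : Type u} {W : ι → Type u} (H : SimpleGraph ι) (F : ∀ i, SimpleGraph (W i))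
    (v : ∀ i, W i) : SimpleGraph (Σ i, W i) :=
  H.map (rootEmbedding v) ⊔ ⨆ i, (F i).map (Function.Embedding.sigmaMk i)

/-- The recursively defined family `𝒢` of graphs, as a family closed under isomorphism. -/
inductive Family : ∀ {V : Type u}, SimpleGraph V → Prop
  /-- `K_2` belongs to the family. -/
  | K2 {V : Type u} (G : SimpleGraph V) (e : G ≃g (⊤ : SimpleGraph (Fin 2))) : Family G
  /-- Every even cycle (of length `2 * k ≥ 4`) belongs to the family. -/
  | evenCycle {V : Type u} (G : SimpleGraph V) (k : ℕ) (hk : 2 ≤ k)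
      (e : G ≃g SimpleGraph.cycleGraph (2 * k)) : Family G
  /-- Given a finite connected graph `H` with at least two vertices, and, for each vertex `i` of `H`,
  a member `F i` of the family with a vertex `v i`, the graph obtained by identifying `i` with
  `v i` for all `i` belongs to the family. -/
  | identify {V : Type u} (G : SimpleGraph V) {ι : Type u} [Finite ι] [Nontrivial ι]
      (H : SimpleGraph ι) (hH : H.Connected) {W : ι → Type u} (F : ∀ i, SimpleGraph (W i))
      (hF : ∀ i, Family (F i)) (v : ∀ i, W i) (e : G ≃g AntiKekule.identify H F v) : Family G

end AntiKekule

/-! ### Matchings as involutions and connectivity through cuts. -/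

namespace AntiKekule

universe u

variable {V : Type u} {G : SimpleGraph V}

/-! Statements (1), (2) and (3) agree because a connected spanning subgraph is `G` minus some edges
and contains a spanning tree. The content is `Robust` ↔ `Family`.

Members of the family are robust: a connected spanning subgraph of an even cycle loses at most one
edge, so one of the two alternating matchings survives. In an identification each `F i` is left only
through its root, so a connected spanning subgraph stays connected on each `F i`, and the matchings
of the pieces combine.

The converse is by induction on the order. Without a cut vertex, a vertex with three neighbours
would allow a connected spanning subgraph with two leaves at one vertex
(`Robust.not_three_neighbors`), so the graph is `K_2` or an even cycle. A cut vertex yields a proper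
even set left only through it. `RootMap.extend` enlarges this to a partition of all vertices into
even sets with one exit each, forcing evenness by a parity argument (`Robust.even_of_rooted`). Each
part is robust (`Robust.induce`), and the exits induce the graph `H`. -/

/-- A perfect matching, given as the map sending each vertex to its partner. -/
def Matchable (G : SimpleGraph V) : Prop :=
  ∃ f : V → V, (∀ w, f (f w) = w) ∧ ∀ w, G.Adj w (f w)

/-- Every connected spanning subgraph has a perfect matching. -/
def Robust (G : SimpleGraph V) : Prop :=
  ∀ G' ≤ G, G'.Connected → Matchable G'

/-- The subgraph of `G` induced on `S ∪ {r}` is connected, expressed by cuts. -/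
def LinkedTo (G : SimpleGraph V) (S : Set V) (r : V) : Prop :=
  ∀ A ⊆ S, A.Nonempty → r ∉ A → ∃ a ∈ A, ∃ b ∈ S, b ∉ A ∧ G.Adj a b

/-- Edges leaving `P` within `S` start at `r`. -/
def RootedIn (G : SimpleGraph V) (S P : Set V) (r : V) : Prop :=
  ∀ a ∈ P, ∀ b ∈ S, b ∉ P → G.Adj a b → a = r

theorem hasPerfectMatching_iff_matchable : HasPerfectMatching G ↔ Matchable G := by
  constructor
  · rintro ⟨M, hM⟩
    rw [SimpleGraph.Subgraph.isPerfectMatching_iff] at hM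
    choose f hf hu using hM
    exact ⟨f, fun w => (hu (f w) w (hf w).symm).symm, fun w => (hf w).adj_sub⟩
  · rintro ⟨f, hf, ha⟩
    refine ⟨⟨Set.univ, fun a b => f a = b, ?_, fun _ => Set.mem_univ _, ?_⟩, ?_⟩
    · rintro a b rfl
      exact ha a
    · exact ⟨by rintro a b rfl; exact hf a⟩
    · rw [SimpleGraph.Subgraph.isPerfectMatching_iff]
      exact fun v => ⟨f v, rfl, fun w hw => Eq.symm (show f v = w from hw)⟩

theorem connected_iff_linkedTo (r : V) : G.Connected ↔ LinkedTo G Set.univ r := by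
  constructor
  · intro h A _ ⟨a, ha⟩ hr
    by_contra! hc
    have key : ∀ x y : V, G.Walk x y → x ∈ A → y ∈ A := by
      intro x y p
      induction p with
      | nil => exact id
      | cons hadj _ ih =>
        intro hx
        refine ih ?_
        by_contra hn
        exact hc _ hx _ (Set.mem_univ _) hn hadj
    obtain ⟨p⟩ := h.preconnected a r
    exact hr (key a r p ha)
  · intro h
    have key : ∀ a, G.Reachable a r := by
      intro a
      by_contra ha
      obtain ⟨x, hx, y, -, hy, hxy⟩ :=
        h {w | ¬ G.Reachable w r} (Set.subset_univ _) ⟨a, ha⟩ (fun hr => hr (.refl _))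
      simp only [Set.mem_ofPred_eq, not_not] at hx hy
      exact hx (hxy.reachable.trans hy)
    have : Nonempty V := ⟨r⟩
    exact ⟨fun a b => (key a).trans (key b).symm⟩

namespace LinkedTo

variable {S T P : Set V} {r s : V}

/-- A cut is symmetric: if `A` contains the old root, use its complement in `S`. -/
theorem change_root (h : LinkedTo G S r) (hs : s ∈ S) : LinkedTo G S s := by
  intro A hA hne hsA
  by_cases hrA : r ∈ A
  · obtain ⟨a, ha, b, hb, hba, hab⟩ :=
      h (S \ A) Set.sdiff_subset ⟨s, hs, hsA⟩ (fun h => h.2 hrA)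
    exact ⟨b, by_contra fun hn => hba ⟨hb, hn⟩, a, ha.1, ha.2, hab.symm⟩
  · exact h A hA hne hrA

/-- An edge from a set avoiding `r` cannot leave `P`, since every exit from `P` starts at `r`. -/
theorem restrict (h : LinkedTo G S r) (hP : P ⊆ S) (hroot : RootedIn G S P r) :
    LinkedTo G P r := by
  intro A hA hne hr
  obtain ⟨a, ha, b, hb, hbA, hab⟩ := h A (hA.trans hP) hne hr
  refine ⟨a, ha, b, by_contra fun hbP => hr ?_, hbA, hab⟩
  exact hroot a (hA ha) b hb hbP hab ▸ ha

theorem union (hS : LinkedTo G S r) (hT : LinkedTo G T r) : LinkedTo G (S ∪ T) r := by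
  intro A hA ⟨a, ha⟩ hr
  rcases hA ha with h | h
  · obtain ⟨x, hx, y, hy, hyA, hxy⟩ :=
      hS (A ∩ S) Set.inter_subset_right ⟨a, ha, h⟩ (fun h => hr h.1)
    exact ⟨x, hx.1, y, .inl hy, fun hn => hyA ⟨hn, hy⟩, hxy⟩
  · obtain ⟨x, hx, y, hy, hyA, hxy⟩ :=
      hT (A ∩ T) Set.inter_subset_right ⟨a, ha, h⟩ (fun h => hr h.1)
    exact ⟨x, hx.1, y, .inr hy, fun hn => hyA ⟨hn, hy⟩, hxy⟩

/-- Two linked sets stay linked when joined by an edge between their roots. -/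
theorem union_of_adj (hS : LinkedTo G S r) (hr : r ∈ S) (hT : LinkedTo G T s) (h : G.Adj s r) :
    LinkedTo G (S ∪ T) r := by
  intro A hA ⟨a, ha⟩ hrA
  by_cases haS : (A ∩ S).Nonempty
  · obtain ⟨x, hx, y, hy, hyA, hxy⟩ :=
      hS (A ∩ S) Set.inter_subset_right haS (fun h => hrA h.1)
    exact ⟨x, hx.1, y, .inl hy, fun hn => hyA ⟨hn, hy⟩, hxy⟩
  · have hAT : A ⊆ T := fun x hx => (hA hx).resolve_left fun hxS => haS ⟨x, hx, hxS⟩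
    by_cases hsA : s ∈ A
    · exact ⟨s, hsA, r, .inl hr, hrA, h⟩
    · obtain ⟨x, hx, y, hy, hyA, hxy⟩ := hT A hAT ⟨a, ha⟩ hsA
      exact ⟨x, hx, y, .inr hy, hyA, hxy⟩

end LinkedTo

/-! ### Parity of sets closed under a matching. -/

section Parity

variable [Finite V] {f : V → V} {S : Set V} {r : V}

theorem even_ncard_of_involution (hf : ∀ w, f (f w) = w) (hne : ∀ w, f w ≠ w)
    (hS : ∀ w ∈ S, f w ∈ S) : Even S.ncard := by
  classical
  have := Fintype.ofFinite V
  rw [Set.ncard_eq_toFinset_card']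
  have h : ∑ _x ∈ S.toFinset, (1 : ZMod 2) = 0 :=
    Finset.sum_involution (fun w _ => f w) (fun _ _ => by decide) (fun w _ _ => hne w)
      (fun w hw => by simpa using hS w (by simpa using hw)) (fun w _ => hf w)
  rw [Finset.sum_const, nsmul_eq_mul, mul_one] at h
  exact (ZMod.natCast_eq_zero_iff_even).1 h

/-- The partner of the root of an even set lies in that set if all other partners do. -/
theorem root_partner_mem (hf : ∀ w, f (f w) = w) (hne : ∀ w, f w ≠ w) (hev : Even S.ncard)
    (hr : r ∈ S) (hS : ∀ w ∈ S, w ≠ r → f w ∈ S) : f r ∈ S := by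
  by_contra hfr
  have h1 : Even (S \ {r}).ncard := by
    refine even_ncard_of_involution hf hne fun w hw => ⟨hS w hw.1 hw.2, ?_⟩
    rintro h
    have h : f w = r := h
    exact hfr (by rw [← h, hf]; exact hw.1)
  have h2 := Set.ncard_sdiff_singleton_add_one hr (Set.toFinite S)
  rw [← h2] at hev
  exact (Nat.even_add_one.1 hev) h1

end Parity

end AntiKekule

/-! ### Partitions of a robust graph into even parts with one exit. -/

namespace AntiKekule

universe u

variable {V : Type u} {G : SimpleGraph V}

namespace Robust

/-- Make `x` and `y` leaves at `v`: the subgraph is still connected, but both leaves need `v` as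
partner. -/
theorem not_two_leaves (hG : Robust G) {v x y : V} (hxy : x ≠ y)
    (hx : G.Adj v x) (hy : G.Adj v y) (hlink : LinkedTo G {x, y}ᶜ v) : False := by
  let G' : SimpleGraph V :=
    { Adj a b := G.Adj a b ∧ ((a = x ∨ a = y) → b = v) ∧ ((b = x ∨ b = y) → a = v)
      symm := ⟨fun a b h => ⟨h.1.symm, h.2.2, h.2.1⟩⟩
      loopless := ⟨fun a h => G.loopless.irrefl a h.1⟩ }
  have hvx := hx.ne
  have hvy := hy.ne
  have hcon : G'.Connected := by
    rw [connected_iff_linkedTo v]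
    intro A _ ⟨a, ha⟩ hv
    by_cases hxA : x ∈ A
    · exact ⟨x, hxA, v, trivial, hv, hx.symm, by grind, by grind⟩
    by_cases hyA : y ∈ A
    · exact ⟨y, hyA, v, trivial, hv, hy.symm, by grind, by grind⟩
    obtain ⟨p, hp, q, hq, hqA, hpq⟩ := hlink A (fun z hz => by grind) ⟨a, ha⟩ hv
    have hq' : q ≠ x ∧ q ≠ y := by simpa using hq
    exact ⟨p, hp, q, trivial, hqA, hpq, by grind, by grind⟩
  obtain ⟨f, hf, hadj⟩ := hG G' (fun _ _ h => h.1) hcon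
  have h1 : f x = v := (hadj x).2.1 (.inl rfl)
  have h2 : f y = v := (hadj y).2.1 (.inr rfl)
  exact hxy (by rw [← hf x, ← hf y, h1, h2])

variable [Finite V] {P : Set V} {r : V}

/-- An even part with a single exit vertex inherits the property. -/
theorem induce (hG : Robust G) (hcon : G.Connected) (hr : r ∈ P) (hev : Even P.ncard)
    (hroot : RootedIn G Set.univ P r) : Robust (G.induce P) := by
  intro G₁ hle hcon₁
  -- Only edges inside `P` are thinned out, to those of `G₁`. By parity a matching of `G'` cannot
  -- leave `P` at `r`, so it restricts to `G₁`.
  let G' : SimpleGraph V :=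
    { Adj a b := G.Adj a b ∧ ∀ (ha : a ∈ P) (hb : b ∈ P), G₁.Adj ⟨a, ha⟩ ⟨b, hb⟩
      symm := ⟨fun a b h => ⟨h.1.symm, fun ha hb => (h.2 hb ha).symm⟩⟩
      loopless := ⟨fun a h => G.loopless.irrefl a h.1⟩ }
  have hcon' : G'.Connected := by
    rw [connected_iff_linkedTo r]
    rw [connected_iff_linkedTo r] at hcon
    rw [connected_iff_linkedTo ⟨r, hr⟩] at hcon₁
    intro A _ hne hrA
    by_cases hAP : (A ∩ P).Nonempty
    · obtain ⟨a, haA, haP⟩ := hAP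
      obtain ⟨x, hx, y, -, hy, hxy⟩ :=
        hcon₁ (Subtype.val ⁻¹' A) (Set.subset_univ _) ⟨⟨a, haP⟩, haA⟩ hrA
      exact ⟨x, hx, y, trivial, hy, hle hxy, fun _ _ => hxy⟩
    · obtain ⟨x, hx, y, -, hy, hxy⟩ := hcon A (Set.subset_univ _) hne hrA
      exact ⟨x, hx, y, trivial, hy, hxy, fun hxP => (hAP ⟨x, hx, hxP⟩).elim⟩
  obtain ⟨f, hf, hadj⟩ := hG G' (fun _ _ h => h.1) hcon'
  have hne : ∀ w, f w ≠ w := fun w => (hadj w).1.ne'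
  have hstay : ∀ w ∈ P, w ≠ r → f w ∈ P := fun w hw hwr =>
    by_contra fun hn => hwr (hroot w hw (f w) trivial hn (hadj w).1)
  have hP : ∀ w ∈ P, f w ∈ P := by
    intro w hw
    by_cases hwr : w = r
    · exact hwr ▸ root_partner_mem hf hne hev hr hstay
    · exact hstay w hw hwr
  exact ⟨fun w => ⟨f w, hP w w.2⟩, fun w => Subtype.ext (hf w), fun w => (hadj w).2 _ _⟩

/-- If `r` is the only exit vertex of the even set `P` and `x` is the only exit vertex of a set `D`
whose complement is connected, then `D` is even. -/
theorem even_of_rooted (hG : Robust G) (hcon : G.Connected) {D : Set V} {x : V}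
    (hP : Even P.ncard) (hrP : r ∈ P) (hrootP : RootedIn G Set.univ P r)
    (hxD : x ∈ D) (hrootD : RootedIn G Set.univ D x) (hPD : Disjoint P D)
    (hadj : G.Adj x r) (hlink : LinkedTo G Dᶜ r) : Even D.ncard := by
  have hrD : r ∉ D := fun h => hPD.le_bot ⟨hrP, h⟩
  have hxP : x ∉ P := fun h => hPD.le_bot ⟨h, hxD⟩
  -- The only edge kept between `D` and its complement is `x r`. By parity `r` is matched inside
  -- `P`, so this edge is not used and the matching preserves `D`.
  let G' : SimpleGraph V :=
    { Adj a b := G.Adj a b ∧ (a ∈ D → b ∉ D → b = r) ∧ (b ∈ D → a ∉ D → a = r)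
      symm := ⟨fun a b h => ⟨h.1.symm, h.2.2, h.2.1⟩⟩
      loopless := ⟨fun a h => G.loopless.irrefl a h.1⟩ }
  have hcon' : G'.Connected := by
    rw [connected_iff_linkedTo r]
    rw [connected_iff_linkedTo x] at hcon
    intro A _ ⟨a, ha⟩ hrA
    by_cases hAD : (A ∩ Dᶜ).Nonempty
    · obtain ⟨p, hp, q, hq, hqA, hpq⟩ :=
        hlink (A ∩ Dᶜ) Set.inter_subset_right hAD (fun h => hrA h.1)
      exact ⟨p, hp.1, q, trivial, fun h => hqA ⟨h, hq⟩, hpq, fun h => (hp.2 h).elim,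
        fun h => (hq h).elim⟩
    have hAD' : A ⊆ D := fun z hz => by_contra fun hn => hAD ⟨z, hz, hn⟩
    by_cases hxA : x ∈ A
    · exact ⟨x, hxA, r, trivial, hrA, hadj, fun _ _ => rfl, fun h => (hrD h).elim⟩
    · obtain ⟨p, hp, q, hq, hqA, hpq⟩ :=
        hcon.restrict (Set.subset_univ _) hrootD A hAD' ⟨a, ha⟩ hxA
      exact ⟨p, hp, q, trivial, hqA, hpq, fun _ h => (h hq).elim, fun _ h => (h (hAD' hp)).elim⟩
  obtain ⟨f, hf, hfadj⟩ := hG G' (fun _ _ h => h.1) hcon'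
  have hne : ∀ w, f w ≠ w := fun w => (hfadj w).1.ne'
  have hfr : f r ∈ P := root_partner_mem hf hne hP hrP fun w hw hwr =>
    by_contra fun hn => hwr (hrootP w hw (f w) trivial hn (hfadj w).1)
  refine even_ncard_of_involution hf hne fun w hw => by_contra fun hn => ?_
  have h1 : f w = r := (hfadj w).2.1 hw hn
  have h2 : w = x := hrootD w hw (f w) trivial hn (hfadj w).1
  exact hxP (by rw [← h2, ← hf w, h1]; exact hfr)

end Robust

/-- The largest set disjoint from `Z` whose only exit vertex is `x`. -/
def dominated (G : SimpleGraph V) (Z : Set V) (x : V) : Set V :=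
  ⋃₀ {A | x ∈ A ∧ Disjoint A Z ∧ RootedIn G Set.univ A x}

theorem subset_dominated {Z A : Set V} {x : V} (hx : x ∈ A) (hd : Disjoint A Z)
    (hA : RootedIn G Set.univ A x) : A ⊆ dominated G Z x :=
  Set.subset_sUnion_of_mem ⟨hx, hd, hA⟩

theorem mem_dominated {Z : Set V} {x : V} (hx : x ∉ Z) : x ∈ dominated G Z x :=
  subset_dominated (A := {x}) rfl (by simpa using hx) (fun _ ha _ _ _ _ => ha) rfl

theorem disjoint_dominated (Z : Set V) (x : V) : Disjoint (dominated G Z x) Z :=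
  Set.disjoint_sUnion_left.2 fun _ hA => hA.2.1

theorem rootedIn_dominated (Z : Set V) (x : V) : RootedIn G Set.univ (dominated G Z x) x := by
  rintro a ⟨A, hA, ha⟩ b - hb hab
  exact hA.2.2 a ha b trivial (fun h => hb ⟨A, hA, h⟩) hab

/-- A set `A` cut off from `r` outside `D = dominated G Z x` misses `Z` because `Z` is linked. Then
`D ∪ A` still has `x` as its only exit, against maximality of `D`. -/
theorem linkedTo_compl_dominated {Z : Set V} {x r : V} (hx : x ∉ Z) (hZ : LinkedTo G Z r) :
    LinkedTo G (dominated G Z x)ᶜ r := by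
  intro A hA ⟨a, ha⟩ hr
  by_contra! hc
  have hdisj := disjoint_dominated (G := G) Z x
  have hAZ : Disjoint A Z := by
    rw [Set.disjoint_iff_inter_eq_empty, ← Set.not_nonempty_iff_eq_empty]
    intro hne
    obtain ⟨p, hp, q, hq, hqA, hpq⟩ := hZ (A ∩ Z) Set.inter_subset_right hne (fun h => hr h.1)
    exact hc p hp.1 q (fun h => hdisj.le_bot ⟨h, hq⟩) (fun h => hqA ⟨h, hq⟩) hpq
  refine hA ha (subset_dominated (A := dominated G Z x ∪ A) (.inl (mem_dominated hx))
    (hdisj.union_left hAZ) ?_ (.inr ha))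
  rintro p (hp | hp) q - hq hpq
  · exact rootedIn_dominated Z x p hp q trivial (fun h => hq (.inl h)) hpq
  · exact (hc p hp q (fun h => hq (.inl h)) (fun h => hq (.inr h)) hpq).elim

/-- `ρ` sends each vertex of `Z` to the root of its part, in a partition of `Z` into even parts
that are left only through their roots. -/
structure RootMap (G : SimpleGraph V) (Z : Set V) (ρ : V → V) : Prop where
  mem : ∀ z ∈ Z, ρ z ∈ Z
  idem : ∀ z ∈ Z, ρ (ρ z) = ρ z
  even : ∀ z ∈ Z, Even {w ∈ Z | ρ w = ρ z}.ncard
  rooted : ∀ z ∈ Z, ∀ w, G.Adj z w → (w ∈ Z ∧ ρ w = ρ z) ∨ ρ z = z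

/-- An edge `x s` enters `Z` at a root `s`, and `dominated G Z x` becomes a new part with root `x`.
Taking the largest such set keeps its complement connected, which the parity argument needs. -/
theorem RootMap.extend [Finite V] (hG : Robust G) (hcon : G.Connected) {Z : Set V} {ρ : V → V}
    {r : V} (hρ : RootMap G Z ρ) (hr : r ∈ Z) (hlink : LinkedTo G Z r) (hZ : Z ≠ Set.univ) :
    ∃ Z' ρ', Z ⊂ Z' ∧ RootMap G Z' ρ' ∧ LinkedTo G Z' r ∧ (∀ z ∈ Z, ρ' z = ρ z) ∧
      ∀ z ∈ Z', z ∉ Z → ρ' z ∉ Z := by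
  classical
  obtain ⟨y, hy⟩ := (Set.ne_univ_iff_exists_notMem Z).1 hZ
  obtain ⟨x, hx, s, -, hs, hxs⟩ := (connected_iff_linkedTo r).1 hcon Zᶜ (Set.subset_univ _)
    ⟨y, hy⟩ (fun h => h hr)
  have hsZ : s ∈ Z := by_contra hs
  have hρs : ρ s = s := (hρ.rooted s hsZ x hxs.symm).resolve_left fun h => hx h.1
  set D := dominated G Z x with hD
  have hxD : x ∈ D := mem_dominated hx
  have hDZ : ∀ z ∈ D, z ∉ Z := fun z hz hz' => (disjoint_dominated (G := G) Z x).le_bot ⟨hz, hz'⟩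
  have hDroot : RootedIn G Set.univ D x := rootedIn_dominated Z x
  have hev : Even D.ncard := by
    refine hG.even_of_rooted hcon (P := {w ∈ Z | ρ w = ρ s}) (r := s) (hρ.even s hsZ) ⟨hsZ, rfl⟩
      ?_ hxD hDroot ?_ hxs ?_
    · rintro a ⟨haZ, ha⟩ b - hb hab
      rcases hρ.rooted a haZ b hab with h | h
      · exact (hb ⟨h.1, h.2.trans ha⟩).elim
      · rw [← h, ha, hρs]
    · exact ((disjoint_dominated (G := G) Z x).symm).mono_left fun w hw => hw.1
    · exact (linkedTo_compl_dominated hx hlink).change_root fun h => hDZ s h hsZ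
  refine ⟨Z ∪ D, fun w => if w ∈ D then x else ρ w, ?_, ⟨?_, ?_, ?_, ?_⟩, ?_, ?_, ?_⟩
  · exact ⟨Set.subset_union_left, fun h => hx (h (.inr hxD))⟩
  · rintro z (hz | hz)
    · have : z ∉ D := fun h => hDZ z h hz
      simpa [this] using Or.inl (hρ.mem z hz)
    · simp [hz, hxD]
  · rintro z (hz | hz)
    · have h1 : z ∉ D := fun h => hDZ z h hz
      have h2 : ρ z ∉ D := fun h => hDZ _ h (hρ.mem z hz)
      simp [h1, h2, hρ.idem z hz]
    · simp [hz, hxD]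
  · rintro z (hz | hz)
    · have h1 : z ∉ D := fun h => hDZ z h hz
      convert hρ.even z hz using 2
      ext w
      have h3 := hρ.mem z hz
      simp only [h1, if_false, Set.mem_ofPred_eq, Set.mem_union]
      constructor
      · rintro ⟨hw, h⟩
        split_ifs at h with hwD
        · exact (hx (h ▸ h3)).elim
        · exact ⟨hw.resolve_right hwD, h⟩
      · rintro ⟨hw, h⟩
        have h4 : w ∉ D := fun h => hDZ w h hw
        simp [hw, h4, h]
    · convert hev using 2
      ext w
      simp only [hz, if_true, Set.mem_ofPred_eq, Set.mem_union]
      constructor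
      · rintro ⟨hw, h⟩
        by_contra hwD
        rw [if_neg hwD] at h
        exact hx (h ▸ hρ.mem w (hw.resolve_right hwD))
      · intro hw
        simp [hw]
  · rintro z (hz | hz) w hzw
    · have h1 : z ∉ D := fun h => hDZ z h hz
      rcases hρ.rooted z hz w hzw with h | h
      · have h4 : w ∉ D := fun h' => hDZ w h' h.1
        exact .inl ⟨.inl h.1, by simp [h1, h4, h.2]⟩
      · exact .inr (by simp [h1, h])
    · by_cases hw : w ∈ D
      · exact .inl ⟨.inr hw, by simp [hz, hw]⟩
      · exact .inr (by simp [hDroot z hz w trivial hw hzw, hxD])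
  · exact (hlink.change_root hsZ).union_of_adj hsZ
      (((connected_iff_linkedTo x).1 hcon).restrict (Set.subset_univ _) hDroot) hxs
      |>.change_root (.inl hr)
  · intro z hz
    have h1 : z ∉ D := fun h => hDZ z h hz
    simp [h1]
  · rintro z (hz | hz) hzZ
    · exact (hzZ hz).elim
    · simpa [hz] using hx

/-- An even set with one exit vertex is a union of parts of a partition of the vertex set. -/
theorem RootMap.exists_univ [Finite V] (hG : Robust G) (hcon : G.Connected) {Z : Set V}
    {ρ : V → V} {r : V} (hρ : RootMap G Z ρ) (hr : r ∈ Z) (hlink : LinkedTo G Z r) :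
    ∃ ρ', RootMap G Set.univ ρ' ∧ (∀ z ∈ Z, ρ' z = ρ z) ∧ ∀ z ∉ Z, ρ' z ∉ Z := by
  induction h : Zᶜ.ncard using Nat.strong_induction_on generalizing Z ρ with
  | _ n ih =>
    by_cases hZ : Z = Set.univ
    · subst hZ
      exact ⟨ρ, hρ, fun _ _ => rfl, fun z hz => (hz trivial).elim⟩
    · obtain ⟨Z', ρ', hss, hρ', hlink', h1, h2⟩ := hρ.extend hG hcon hr hlink hZ
      obtain ⟨ρ₂, hρ₂, h3, h4⟩ := ih _ (h ▸ Set.ncard_lt_ncard (compl_lt_compl_iff_lt.2 hss))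
        hρ' (hss.1 hr) hlink' rfl
      refine ⟨ρ₂, hρ₂, fun z hz => (h3 z (hss.1 hz)).trans (h1 z hz), fun z hz => ?_⟩
      by_cases hz' : z ∈ Z'
      · exact h3 z hz' ▸ h2 z hz' hz
      · exact fun h => h4 z hz' (hss.1 h)

end AntiKekule

/-! ### Robust graphs without a cut vertex have maximum degree two. -/

namespace AntiKekule

universe u

variable {V : Type u} {G : SimpleGraph V}

/-- `G` has no cut vertex. -/
def NoCutVertex (G : SimpleGraph V) : Prop :=
  ∀ c r, r ≠ c → LinkedTo G {c}ᶜ r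

/-- `C` is separated from the rest of the induced subgraph on `X` by the vertex `c`. -/
structure Fragment (G : SimpleGraph V) (X C : Set V) (c : V) : Prop where
  subset : C ⊆ X
  mem : c ∈ X
  notMem : c ∉ C
  nonempty : C.Nonempty
  eq_of_adj : ∀ a ∈ C, ∀ b ∈ X, b ∉ C → G.Adj a b → b = c

namespace Fragment

variable {X C C₁ C₂ N : Set V} {c : V}

theorem linkedTo_sdiff (h : Fragment G X C c) (hX : LinkedTo G X c) : LinkedTo G (X \ C) c :=
  hX.restrict Set.sdiff_subset fun a ha b hb hbC hab =>
    h.eq_of_adj b (by_contra fun hn => hbC ⟨hb, hn⟩) a ha.1 ha.2 hab.symm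

/-- If deleting a chosen `x ∈ C ∩ N` disconnects `X`, a piece cut off from `c` lies in `C` and is a
smaller fragment at `x`; descend into it. -/
theorem exists_linkedTo_sdiff [Finite V] (hN : ∀ C c, Fragment G X C c → ∃ n ∈ C, n ∈ N)
    (h : Fragment G X C c) (hX : LinkedTo G X c) :
    ∃ x ∈ C, x ∈ N ∧ LinkedTo G (X \ {x}) c := by
  induction hn : C.ncard using Nat.strong_induction_on generalizing C c with
  | _ n ih =>
    obtain ⟨x, hxC, hxN⟩ := hN C c h
    by_cases hx : LinkedTo G (X \ {x}) c
    · exact ⟨x, hxC, hxN, hx⟩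
    unfold LinkedTo at hx
    push Not at hx
    obtain ⟨A, hA, hne, hcA, hcut⟩ := hx
    have hAC : A ⊆ C := by
      by_contra hAC
      obtain ⟨a, ha, haC⟩ := Set.not_subset.1 hAC
      obtain ⟨p, hp, q, hq, hqA, hpq⟩ := h.linkedTo_sdiff hX (A ∩ (X \ C))
        Set.inter_subset_right ⟨a, ha, (hA ha).1, haC⟩ (fun h => hcA h.1)
      exact hcut p hp.1 q ⟨hq.1, fun h => hq.2 (h ▸ hxC)⟩ (fun h => hqA ⟨h, hq⟩) hpq
    have hxA : x ∉ A := fun hx => (hA hx).2 rfl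
    have hfrag : Fragment G X A x := ⟨fun a ha => (hA ha).1, h.subset hxC, hxA, hne,
      fun a ha b hb hbA hab => by_contra fun hbx => hcut a ha b ⟨hb, hbx⟩ hbA hab⟩
    have hlt : A.ncard < n := hn ▸ Set.ncard_lt_ncard ⟨hAC, fun h => hxA (h hxC)⟩
    obtain ⟨y, hy, hyN, hlink⟩ := ih _ hlt hfrag (hX.change_root (h.subset hxC)) rfl
    exact ⟨y, hAC hy, hyN, hlink.change_root ⟨h.mem, fun hc => hcA (hc ▸ hy)⟩⟩

theorem exists_pair [Finite V] (hN : ∀ C c, Fragment G X C c → ∃ n ∈ C, n ∈ N)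
    (h₁ : Fragment G X C₁ c) (h₂ : Fragment G X C₂ c) (hdisj : Disjoint C₁ C₂)
    (hX : LinkedTo G X c) :
    ∃ x ∈ X ∩ N, ∃ y ∈ X ∩ N, x ≠ y ∧ x ≠ c ∧ y ≠ c ∧ LinkedTo G (X \ {x, y}) c := by
  obtain ⟨x, hx, hxN, hlx⟩ := h₁.exists_linkedTo_sdiff hN hX
  obtain ⟨y, hy, hyN, hly⟩ := h₂.exists_linkedTo_sdiff hN hX
  have hx₂ : x ∉ C₂ := fun h => hdisj.le_bot ⟨hx, h⟩
  have hy₁ : y ∉ C₁ := fun h => hdisj.le_bot ⟨h, hy⟩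
  have hxc : x ≠ c := fun h => h₁.notMem (h ▸ hx)
  have hyc : y ≠ c := fun h => h₂.notMem (h ▸ hy)
  have f₂ : Fragment G (X \ {x}) C₂ c := ⟨fun a ha => ⟨h₂.subset ha, fun h => hx₂ (h ▸ ha)⟩,
    ⟨h₁.mem, hxc.symm⟩, h₂.notMem, h₂.nonempty, fun a ha b hb => h₂.eq_of_adj a ha b hb.1⟩
  have f₁ : Fragment G (X \ {y}) C₁ c := ⟨fun a ha => ⟨h₁.subset ha, fun h => hy₁ (h ▸ ha)⟩,
    ⟨h₁.mem, hyc.symm⟩, h₁.notMem, h₁.nonempty, fun a ha b hb => h₁.eq_of_adj a ha b hb.1⟩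
  refine ⟨x, ⟨h₁.subset hx, hxN⟩, y, ⟨h₂.subset hy, hyN⟩, fun h => hx₂ (h ▸ hy), hxc, hyc, ?_⟩
  -- `X \ {x, y}` is the union of `X \ C₂` without `x` and `X \ C₁` without `y`, which share `c`.
  convert (f₂.linkedTo_sdiff hlx).union (f₁.linkedTo_sdiff hly) using 1
  ext z
  have hd : z ∈ C₁ → z ∉ C₂ := fun h h' => hdisj.le_bot ⟨h, h'⟩
  simp only [Set.mem_sdiff, Set.mem_insert_iff, Set.mem_singleton_iff, Set.mem_union]
  by_cases hzx : z = x
  · subst hzx; simp [hx]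
  · by_cases hzy : z = y
    · subst hzy; simp [hy]
    · simp only [hzx, hzy]
      tauto

end Fragment

/-- If deleting `c` disconnects `X`, there are two vertices of `N` whose deletion does not. -/
theorem exists_pair_of_not_linkedTo [Finite V] {X N : Set V} {c r : V}
    (hN : ∀ C c, Fragment G X C c → ∃ n ∈ C, n ∈ N) (hX : LinkedTo G X c)
    (hc : c ∈ X) (hr : r ∈ X \ {c}) (hcut : ¬ LinkedTo G (X \ {c}) r) :
    ∃ x ∈ X ∩ N, ∃ y ∈ X ∩ N, x ≠ y ∧ x ≠ c ∧ y ≠ c ∧ LinkedTo G (X \ {x, y}) c := by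
  unfold LinkedTo at hcut
  push Not at hcut
  obtain ⟨A, hA, hne, hrA, hcut⟩ := hcut
  refine Fragment.exists_pair (C₁ := A) (C₂ := (X \ {c}) \ A) hN
    ⟨fun a ha => (hA ha).1, hc, fun h => (hA h).2 rfl, hne, fun a ha b hb hbA hab =>
      by_contra fun hbc => hcut a ha b ⟨hb, hbc⟩ hbA hab⟩
    ⟨fun a ha => ha.1.1, hc, fun h => h.1.2 rfl, ⟨r, hr, hrA⟩, fun a ha b hb hbA hab => ?_⟩
    Set.disjoint_sdiff_right hX
  by_contra hbc
  exact hcut b (by_contra fun hn => hbA ⟨⟨hb, hbc⟩, hn⟩) a ha.1 ha.2 hab.symm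

theorem Robust.not_three_neighbors [Finite V] (hG : Robust G) (hcut : NoCutVertex G) {v x y z : V}
    (hx : G.Adj v x) (hy : G.Adj v y) (hz : G.Adj v z) (hxy : x ≠ y) (hxz : x ≠ z) (hyz : y ≠ z) :
    False := by
  have hsingle : ∀ v : V, LinkedTo G {v} v := fun v A hA ⟨a, ha⟩ hv => by
    have : a = v := hA ha
    exact (hv (this ▸ ha)).elim
  -- it suffices to delete two neighbours of a vertex `v` and keep the rest of `V \ {v}` connected
  have hleaf : ∀ {v x y z : V}, G.Adj v x → G.Adj v y → G.Adj v z → x ≠ y → z ≠ x → z ≠ y →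
      LinkedTo G ({v}ᶜ \ {x, y}) z → False := by
    intro v x y z hx hy hz hxy hzx hzy h
    refine hG.not_two_leaves hxy hx hy ?_
    convert (h.union_of_adj ⟨hz.ne', by simp [hzx, hzy]⟩ (hsingle v) hz).change_root (s := v)
      (.inr rfl) using 1
    ext w
    have := hx.ne
    have := hy.ne
    simp only [Set.mem_compl_iff, Set.mem_insert_iff, Set.mem_singleton_iff, Set.mem_union,
      Set.mem_sdiff]
    grind
  have hfrag : ∀ C c, Fragment G {v}ᶜ C c → ∃ n ∈ C, n ∈ {n | G.Adj v n} := by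
    intro C c hC
    have hvC : v ∉ C := fun h => hC.subset h rfl
    obtain ⟨a, ha, b, hb, hbC, hab⟩ := hcut c v (fun h => hC.mem h.symm) C
      (fun a ha h => hC.notMem (h ▸ ha)) hC.nonempty hvC
    refine ⟨a, ha, ?_⟩
    by_cases hbv : b = v
    · exact hbv ▸ hab.symm
    · exact (hb (hC.eq_of_adj a ha b hbv hbC hab)).elim
  by_cases hbi : ∀ c ∈ ({v}ᶜ : Set V), ∀ r ∈ ({v}ᶜ : Set V) \ {c}, LinkedTo G ({v}ᶜ \ {c}) r
  · by_cases hyc : LinkedTo G (({v}ᶜ \ {x}) \ {y}) z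
    · refine hleaf hx hy hz hxy hxz.symm hyz.symm ?_
      convert hyc using 1
      ext w
      simp only [Set.mem_compl_iff, Set.mem_insert_iff, Set.mem_singleton_iff, Set.mem_sdiff]
      tauto
    -- Here `y` is a cut vertex of `G - v - x`. As `G - v` has none, every fragment meets the
    -- neighbours of `x`. Two of these become leaves at `x`, which stays attached through `v` and
    -- `y`.
    · have hfrag' : ∀ C c, Fragment G ({v}ᶜ \ {x}) C c → ∃ n ∈ C, n ∈ {n | G.Adj x n} := by
        intro C c hC
        have hxC : x ∉ C := fun h => (hC.subset h).2 rfl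
        obtain ⟨a, ha, b, hb, hbC, hab⟩ := hbi c hC.mem.1 x ⟨hx.ne', fun h => hC.mem.2 h.symm⟩ C
          (fun a ha => ⟨(hC.subset ha).1, fun h => hC.notMem (h ▸ ha)⟩) hC.nonempty hxC
        refine ⟨a, ha, ?_⟩
        by_cases hbx : b = x
        · exact hbx ▸ hab.symm
        · exact (hb.2 (hC.eq_of_adj a ha b ⟨hb.1, hbx⟩ hbC hab)).elim
      have hyX : y ∈ ({v}ᶜ : Set V) \ {x} := ⟨hy.ne', hxy.symm⟩
      obtain ⟨p, hp, q, hq, hpq, hpy, hqy, hlink⟩ := exists_pair_of_not_linkedTo hfrag'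
        (hbi x hx.ne' y hyX) hyX ⟨⟨hz.ne', hxz.symm⟩, hyz.symm⟩ hyc
      refine hleaf hp.2 hq.2 hx.symm hpq (fun h => hp.1.1 h.symm) (fun h => hq.1.1 h.symm) ?_
      convert (hlink.union_of_adj ⟨hyX, by simp [hpy.symm, hqy.symm]⟩ (hsingle v) hy).change_root
        (s := v) (.inr rfl) using 1
      ext w
      have := hx.ne
      have : p ≠ v := hp.1.1
      have : q ≠ v := hq.1.1
      simp only [Set.mem_compl_iff, Set.mem_insert_iff, Set.mem_singleton_iff, Set.mem_sdiff,
        Set.mem_union]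
      grind
  -- Here `G - v` has a cut vertex `c`. Two neighbours of `v` on different sides of `c` become
  -- leaves, and a third neighbour keeps `v` attached.
  · push Not at hbi
    obtain ⟨c, hc, r, hr, hcut'⟩ := hbi
    obtain ⟨p, hp, q, hq, hpq, hpc, hqc, hlink⟩ :=
      exists_pair_of_not_linkedTo hfrag (hcut v c hc) hc hr hcut'
    obtain ⟨w, hw, hwp, hwq⟩ : ∃ w, G.Adj v w ∧ w ≠ p ∧ w ≠ q := by
      by_contra! hn
      have key : ∀ w, G.Adj v w → w = p ∨ w = q := fun w hw => or_iff_not_imp_left.2 (hn w hw)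
      rcases key x hx with h1 | h1 <;> rcases key y hy with h2 | h2 <;>
        rcases key z hz with h3 | h3 <;>
        first
          | exact hxy (h1.trans h2.symm)
          | exact hxz (h1.trans h3.symm)
          | exact hyz (h2.trans h3.symm)
    exact hleaf hp.2 hq.2 hw hpq hwp hwq
      (hlink.change_root ⟨hw.ne', by simp [hwp, hwq]⟩)

/-- A connected graph with all degrees equal to two is a cycle. -/
theorem exists_cycleGraph_iso [Finite V] (hcon : G.Connected)
    (h2 : ∀ v, ∃ x y, x ≠ y ∧ G.Adj v x ∧ G.Adj v y)
    (h3 : ∀ v x y z, G.Adj v x → G.Adj v y → G.Adj v z → x = y ∨ x = z ∨ y = z) :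
    ∃ n, 3 ≤ n ∧ Nonempty (G ≃g SimpleGraph.cycleGraph n) := by
  classical
  have := Fintype.ofFinite V
  have hnt : Nontrivial V := by
    obtain ⟨v⟩ := hcon.nonempty
    obtain ⟨x, -, -, hx, -⟩ := h2 v
    exact ⟨v, x, hx.ne⟩
  have hcyc : ¬ G.IsAcyclic := by
    intro h
    obtain ⟨v, hv⟩ := SimpleGraph.IsTree.exists_vert_degree_one_of_nontrivial (G := G) ⟨hcon, h⟩
    obtain ⟨x, y, hxy, hx, hy⟩ := h2 v
    rw [SimpleGraph.degree_eq_one_iff_existsUnique_adj] at hv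
    exact hxy (hv.unique hx hy)
  unfold SimpleGraph.IsAcyclic at hcyc
  push Not at hcyc
  obtain ⟨u, p, hp⟩ := hcyc
  have hlen := hp.three_le_length
  obtain ⟨n, hn⟩ : ∃ n, p.length = n + 2 := ⟨p.length - 2, by omega⟩
  have hinj : Function.Injective fun i : Fin (n + 2) => p.getVert i := by
    intro i j hij
    exact Fin.ext (hp.getVert_injOn' (by simp; omega) (by simp; omega) hij)
  have hsucc : ∀ i : Fin (n + 2), G.Adj (p.getVert i) (p.getVert (i + 1 : Fin (n + 2))) := by
    intro i
    have h := p.adj_getVert_succ (i := i) (by omega)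
    by_cases hi : i = Fin.last (n + 1)
    · subst hi
      rw [Fin.last_add_one]
      have h0 : p.getVert (n + 1 + 1) = p.getVert 0 := by
        rw [show n + 1 + 1 = p.length from hn.symm]; simp
      simpa [h0] using h
    · rwa [Fin.val_add_one_of_lt (Fin.lt_last_iff_ne_last.2 hi)]
  have hadj : ∀ i : Fin (n + 2), ∀ w, G.Adj (p.getVert i) w →
      w = p.getVert (i + 1 : Fin (n + 2)) ∨ w = p.getVert (i - 1 : Fin (n + 2)) := by
    intro i w hw
    have ha := hsucc i
    have hb := hsucc (i - 1)
    rw [sub_add_cancel] at hb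
    have hne : p.getVert (i + 1 : Fin (n + 2)) ≠ p.getVert (i - 1 : Fin (n + 2)) := by
      intro h
      have h' : i + 1 = i - 1 := hinj h
      -- Impossible, as the cycle has length `n + 2 ≥ 3`.
      have h'' : (1 : Fin (n + 2)) + 1 = 0 := by
        have := congrArg (fun t => t - i + 1) h'
        simpa using this
      have h4 := congrArg Fin.val h''
      obtain ⟨m, rfl⟩ : ∃ m, n = m + 1 := ⟨n - 1, by omega⟩
      simp [Fin.val_add, Nat.mod_eq_of_lt (show 2 < m + 1 + 2 by omega)] at h4
    rcases h3 _ _ _ _ hw ha hb.symm with h | h | h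
    · exact .inl h
    · exact .inr h
    · exact (hne h).elim
  -- The cycle already uses both neighbours of each of its vertices, so no edge leaves it.
  have hsurj : Function.Surjective fun i : Fin (n + 2) => p.getVert i := by
    by_contra hns
    rw [← Set.range_eq_univ] at hns
    obtain ⟨w, hw⟩ := (Set.ne_univ_iff_exists_notMem _).1 hns
    obtain ⟨a, ha, b, -, hb, hab⟩ := (connected_iff_linkedTo w).1 hcon _ (Set.subset_univ _)
      (Set.range_nonempty _) hw
    obtain ⟨i, rfl⟩ := ha
    rcases hadj i b hab with rfl | rfl
    · exact hb ⟨_, rfl⟩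
    · exact hb ⟨_, rfl⟩
  refine ⟨n + 2, by omega, ⟨SimpleGraph.Iso.symm ⟨Equiv.ofBijective _ ⟨hinj, hsurj⟩, ?_⟩⟩⟩
  intro i j
  rw [SimpleGraph.cycleGraph_adj]
  change G.Adj (p.getVert i) (p.getVert j) ↔ _
  constructor
  · intro h
    rcases hadj i _ h with h | h
    · right
      rw [show j = i + 1 from hinj h]; simp
    · left
      rw [show j = i - 1 from hinj h]; simp
  · rintro (h | h)
    · have := hsucc j
      rw [← h] at this
      simpa using this.symm
    · have := hsucc i
      rw [← h] at this
      simpa using this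

end AntiKekule

/-! ### Members of the family are robust. -/

namespace AntiKekule

universe u

theorem identify_adj {ι : Type u} {W : ι → Type u} {H : SimpleGraph ι}
    {F : ∀ i, SimpleGraph (W i)} {v : ∀ i, W i} {s t : Σ i, W i} :
    (identify H F v).Adj s t ↔ (H.Adj s.1 t.1 ∧ s.2 = v s.1 ∧ t.2 = v t.1) ∨
      ∃ i a b, (F i).Adj a b ∧ ⟨i, a⟩ = s ∧ ⟨i, b⟩ = t := by
  obtain ⟨i, a⟩ := s
  obtain ⟨j, b⟩ := t
  simp only [identify, SimpleGraph.sup_adj, SimpleGraph.iSup_adj, SimpleGraph.map_adj]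
  refine or_congr ⟨?_, ?_⟩ Iff.rfl
  · rintro ⟨x, y, h, hx, hy⟩
    cases hx
    cases hy
    exact ⟨h, rfl, rfl⟩
  · rintro ⟨h, ha, hb⟩
    exact ⟨i, j, h, Sigma.ext rfl (heq_of_eq ha.symm), Sigma.ext rfl (heq_of_eq hb.symm)⟩

section RobustOfFamily

theorem Robust.of_iso {V W : Type*} {G : SimpleGraph V} {G₂ : SimpleGraph W} (e : G ≃g G₂)
    (h : Robust G₂) : Robust G := by
  intro G' hle hcon
  have hle' : G'.comap e.symm ≤ G₂ := by
    intro a b hab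
    have h1 : G.Adj (e.symm a) (e.symm b) := hle hab
    exact e.symm.map_adj_iff.1 h1
  let e' : G'.comap e.symm ≃g G' := ⟨e.symm.toEquiv, Iff.rfl⟩
  obtain ⟨f, hf, hadj⟩ := h _ hle' (e'.connected_iff.2 hcon)
  refine ⟨fun w => e.symm (f (e w)), fun w => by simp [hf], fun w => ?_⟩
  have h1 : G'.Adj (e.symm (e w)) (e.symm (f (e w))) := hadj (e w)
  rwa [e.symm_apply_apply] at h1

theorem robust_top_fin_two : Robust (⊤ : SimpleGraph (Fin 2)) := by
  intro G' _ hcon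
  obtain ⟨a, ha, b, -, hb, hab⟩ := (connected_iff_linkedTo 1).1 hcon {0} (Set.subset_univ _)
    ⟨0, rfl⟩ (by simp)
  have ha' : a = 0 := ha
  have hb' : b = 1 := by
    have : b ≠ 0 := hb
    omega
  subst ha' hb'
  refine ⟨![1, 0], fun w => ?_, fun w => ?_⟩
  · fin_cases w <;> rfl
  · fin_cases w
    · exact hab
    · exact hab.symm

/-- A connected spanning subgraph of a cycle misses at most one edge. -/
theorem adj_succ_of_connected {n : ℕ} {G' : SimpleGraph (Fin (n + 2))}
    (hle : G' ≤ SimpleGraph.cycleGraph (n + 2)) (hcon : G'.Connected) {i j : Fin (n + 2)}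
    (hij : i < j) : G'.Adj i (i + 1) ∨ G'.Adj j (j + 1) := by
  by_contra! hn
  -- In the cycle this arc is left only through the two edges assumed missing.
  obtain ⟨a, ha, b, -, hb, hab⟩ := (connected_iff_linkedTo i).1 hcon {x | i < x ∧ x ≤ j}
    (Set.subset_univ _) ⟨j, hij, le_rfl⟩ (fun h => lt_irrefl _ h.1)
  simp only [Set.mem_ofPred_eq] at ha hb
  rcases SimpleGraph.cycleGraph_adj.1 (hle hab) with h | h
  · have hba : a = b + 1 := by rw [← h]; simp
    subst hba
    have hbi : b ≠ i := fun h => hn.1 (h ▸ hab.symm)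
    by_cases hbl : b = Fin.last (n + 1)
    · subst hbl
      rw [Fin.last_add_one] at ha
      exact absurd ha.1 (by simp)
    · have hval := Fin.val_add_one_of_lt (Fin.lt_last_iff_ne_last.2 hbl)
      have hne := Fin.val_ne_of_ne hbi
      rw [Fin.lt_def, Fin.le_def, hval] at ha
      rw [Fin.lt_def, Fin.le_def] at hb
      omega
  · have hba : b = a + 1 := by rw [← h]; simp
    subst hba
    have haj : a ≠ j := fun h => hn.2 (h ▸ hab)
    have hal : a ≠ Fin.last (n + 1) := fun h => haj (le_antisymm ha.2 (h ▸ Fin.le_last j))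
    have hval := Fin.val_add_one_of_lt (Fin.lt_last_iff_ne_last.2 hal)
    have hne := Fin.val_ne_of_ne haj
    rw [Fin.lt_def, Fin.le_def, hval] at hb
    rw [Fin.lt_def, Fin.le_def] at ha
    omega

theorem robust_cycleGraph {n : ℕ} (hn : Even n) :
    Robust (SimpleGraph.cycleGraph (n + 2)) := by
  classical
  intro G' hle hcon
  have hpar : ∀ x : Fin (n + 2), Even (x + 1).val ↔ ¬ Even x.val := by
    intro x
    by_cases hx : x = Fin.last (n + 1)
    · subst hx
      rw [Fin.last_add_one]
      simp [Nat.even_add_one, hn]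
    · rw [Fin.val_add_one_of_lt (Fin.lt_last_iff_ne_last.2 hx), Nat.even_add_one]
  -- `E` selects the starting points of alternate edges; the even length makes parity alternate
  -- across the wrap from the last vertex to `0`.
  have key : ∀ E : Fin (n + 2) → Prop, (∀ x, E (x + 1) ↔ ¬ E x) →
      (∀ x, E x → G'.Adj x (x + 1)) → Matchable G' := by
    intro E hE hadj
    have hE' : ∀ x, ¬ E x → E (x - 1) := fun x hx => by
      have := hE (x - 1)
      rw [sub_add_cancel] at this
      tauto
    refine ⟨fun x => if E x then x + 1 else x - 1, fun x => ?_, fun x => ?_⟩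
    · by_cases hx : E x
      · simp [hx, hE]
      · simp [hx, hE' x hx]
    · by_cases hx : E x
      · simpa [hx] using hadj x hx
      · have := hadj _ (hE' x hx)
        rw [sub_add_cancel] at this
        simpa [hx] using this.symm
  by_cases hall : ∀ x : Fin (n + 2), Even x.val → G'.Adj x (x + 1)
  · exact key _ hpar hall
  · push Not at hall
    obtain ⟨i, hi, hni⟩ := hall
    -- The one missing edge starts at an even vertex, so all edges starting at odd vertices are
    -- present.
    refine key (fun x => ¬ Even x.val) (fun x => not_congr (hpar x)) fun j hj => ?_
    rcases lt_trichotomy i j with h | h | h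
    · exact (adj_succ_of_connected hle hcon h).resolve_left hni
    · exact (hj (h ▸ hi)).elim
    · exact (adj_succ_of_connected hle hcon h).resolve_right hni

theorem robust_identify {ι : Type u} {W : ι → Type u} {H : SimpleGraph ι}
    {F : ∀ i, SimpleGraph (W i)} {v : ∀ i, W i} (hF : ∀ i, Robust (F i)) :
    Robust (identify H F v) := by
  intro G' hle hcon
  have hM : ∀ i, Matchable (G'.comap (Sigma.mk i)) := by
    intro i
    refine hF i _ ?_ ?_
    · intro a b hab
      rcases identify_adj.1 (hle hab) with h | ⟨j, x, y, hxy, hx, hy⟩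
      · exact (H.loopless.irrefl _ h.1).elim
      · cases hx
        cases hy
        exact hxy
    · rw [connected_iff_linkedTo (v i)]
      rintro A - hA hvA
      have hinj : Function.Injective (Sigma.mk i : W i → Σ i, W i) := sigma_mk_injective
      obtain ⟨_, ⟨a, ha, rfl⟩, ⟨j, b⟩, -, hb, hab⟩ :=
        (connected_iff_linkedTo ⟨i, v i⟩).1 hcon (Sigma.mk i '' A) (Set.subset_univ _)
          (hA.image _) (fun h => hvA ((hinj.mem_set_image).1 h))
      rcases identify_adj.1 (hle hab) with h | ⟨j', x, y, -, hx, hy⟩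
      · have h1 : a = v i := h.2.1
        exact (hvA (h1 ▸ ha)).elim
      · cases hx
        cases hy
        exact ⟨a, ha, y, trivial, fun h => hb ⟨y, h, rfl⟩, hab⟩
  choose f hf hadj using hM
  exact ⟨fun s => ⟨s.1, f s.1 s.2⟩, fun s => by simp [hf], fun s => hadj s.1 s.2⟩

theorem Family.robust {V : Type u} {G : SimpleGraph V} (h : Family G) : Robust G := by
  induction h with
  | K2 G e => exact robust_top_fin_two.of_iso e
  | evenCycle G k hk e =>
    obtain ⟨n, hn⟩ : ∃ n, 2 * k = n + 2 := ⟨2 * k - 2, by omega⟩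
    rw [hn] at e
    exact (robust_cycleGraph ⟨k - 1, by omega⟩).of_iso e
  | identify G H hH F hF v e ih => exact (robust_identify ih).of_iso e

end RobustOfFamily

/-! ### Connected robust graphs belong to the family. -/

section FamilyOfRobust

variable {V : Type u} {G : SimpleGraph V}

theorem LinkedTo.connected_induce {P : Set V} {r : V} (h : LinkedTo G P r) (hr : r ∈ P) :
    (G.induce P).Connected := by
  rw [connected_iff_linkedTo ⟨r, hr⟩]
  rintro A - hA hrA
  obtain ⟨_, ⟨a, ha, rfl⟩, b, hb, hbA, hab⟩ := h (Subtype.val '' A)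
    (Subtype.coe_image_subset _ _) (hA.image _)
    (fun h => hrA (by obtain ⟨x, hx, hxr⟩ := h; rwa [show x = ⟨r, hr⟩ from Subtype.ext hxr] at hx))
  exact ⟨a, ha, ⟨b, hb⟩, trivial, fun h => hbA ⟨_, h, rfl⟩, hab⟩

/-- A graph is obtained by identification from the parts of a partition given by a root map. -/
def RootMap.iso {ρ : V → V} (hρ : RootMap G Set.univ ρ) :
    G ≃g AntiKekule.identify (G.induce {r | ρ r = r})
      (fun i : {r | ρ r = r} => G.induce {w | ρ w = i}) (fun i => ⟨i, i.2⟩) where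
  toFun w := ⟨⟨ρ w, hρ.idem w trivial⟩, ⟨w, rfl⟩⟩
  invFun s := s.2.1
  left_inv _ := rfl
  right_inv := by
    rintro ⟨⟨i, hi⟩, ⟨w, hw⟩⟩
    have hw : ρ w = i := hw
    subst hw
    rfl
  map_rel_iff' := by
    intro a b
    simp only [Equiv.coe_fn_mk, identify_adj]
    constructor
    · rintro (⟨h, ha, hb⟩ | ⟨i, x, y, hxy, hx, hy⟩)
      · have ha : a = ρ a := congrArg Subtype.val ha
        have hb : b = ρ b := congrArg Subtype.val hb
        have h : G.Adj (ρ a) (ρ b) := h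
        rwa [← ha, ← hb] at h
      · have h1 : x.1 = a := congrArg (fun s : Σ i : {r | ρ r = r}, {w | ρ w = i} => s.2.1) hx
        have h2 : y.1 = b := congrArg (fun s : Σ i : {r | ρ r = r}, {w | ρ w = i} => s.2.1) hy
        rw [← h1, ← h2]
        exact hxy
    · intro hab
      by_cases hρab : ρ b = ρ a
      · refine .inr ⟨⟨ρ a, hρ.idem a trivial⟩, ⟨a, rfl⟩, ⟨b, hρab⟩, hab, rfl, ?_⟩
        -- The root is a variable here so that `ρ b = i` can be substituted in the dependent pair.
        have key : ∀ i (h : ρ b = i) (hi : ρ i = i),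
            (⟨⟨i, hi⟩, ⟨b, h⟩⟩ : Σ i : {r | ρ r = r}, {w | ρ w = i}) =
              ⟨⟨ρ b, hρ.idem b trivial⟩, ⟨b, rfl⟩⟩ := by
          rintro _ rfl _
          rfl
        exact key _ hρab _
      · have ha : ρ a = a := (hρ.rooted a trivial b hab).resolve_left fun h => hρab h.2
        have hb : ρ b = b :=
          (hρ.rooted b trivial a hab.symm).resolve_left fun h => hρab h.2.symm
        refine .inl ⟨?_, Subtype.ext ha.symm, Subtype.ext hb.symm⟩
        change G.Adj (ρ a) (ρ b)
        rwa [ha, hb]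

theorem RootMap.connected_roots {ρ : V → V} (hρ : RootMap G Set.univ ρ) (hcon : G.Connected) :
    (G.induce {r | ρ r = r}).Connected := by
  obtain ⟨w⟩ := hcon.nonempty
  have hw : ρ (ρ w) = ρ w := hρ.idem w trivial
  rw [connected_iff_linkedTo ⟨ρ w, hw⟩]
  rintro A - ⟨⟨a, ha⟩, haA⟩ hwA
  have ha : ρ a = a := ha
  obtain ⟨x, ⟨p, hp, hpx⟩, y, -, hy, hxy⟩ := (connected_iff_linkedTo w).1 hcon
    {z | ∃ p ∈ A, p.1 = ρ z} (Set.subset_univ _) ⟨a, ⟨a, ha⟩, haA, ha.symm⟩ (by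
      rintro ⟨p, hp, hpw⟩
      exact hwA (by rwa [show p = ⟨ρ w, hw⟩ from Subtype.ext hpw] at hp))
  have hne : ρ y ≠ ρ x := fun h => hy ⟨p, hp, hpx.trans h.symm⟩
  have hx : ρ x = x := (hρ.rooted x trivial y hxy).resolve_left fun h => hne h.2
  have hy' : ρ y = y := (hρ.rooted y trivial x hxy.symm).resolve_left fun h => hne h.2.symm
  refine ⟨p, hp, ⟨y, hy'⟩, trivial, fun h => hy ⟨_, h, hy'.symm⟩, ?_⟩
  change G.Adj p.1 y
  rwa [hpx, hx]

/-- A cut vertex is the only exit vertex of some proper even set. -/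
theorem Matchable.exists_even_of_not_linkedTo [Finite V] (hM : Matchable G) {c r : V} (hr : r ≠ c)
    (hcut : ¬ LinkedTo G {c}ᶜ r) :
    ∃ P : Set V, c ∈ P ∧ P ≠ Set.univ ∧ Even P.ncard ∧ RootedIn G Set.univ P c := by
  obtain ⟨f, hf, hadj⟩ := hM
  have hne : ∀ w, f w ≠ w := fun w => (hadj w).ne'
  unfold LinkedTo at hcut
  push Not at hcut
  obtain ⟨A, hA, hAne, hrA, hcut⟩ := hcut
  -- `E` is the side of the cut at `c` without the partner of `c`: the matching preserves it, so it
  -- is even, and its complement is the required set.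
  obtain ⟨E, hEne, hcE, hEev, hE⟩ : ∃ E : Set V, E.Nonempty ∧ c ∉ E ∧ Even E.ncard ∧
      ∀ a ∈ E, ∀ b ∉ E, G.Adj a b → b = c := by
    by_cases hfc : f c ∈ A
    · have hE : ∀ a ∈ {c}ᶜ \ A, ∀ b ∉ {c}ᶜ \ A, G.Adj a b → b = c := fun a ha b hb hab =>
        by_contra fun hbc => hcut b (by_contra fun h => hb ⟨hbc, h⟩) a ha.1 ha.2 hab.symm
      refine ⟨{c}ᶜ \ A, ⟨r, hr, hrA⟩, fun h => h.1 rfl,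
        even_ncard_of_involution hf hne fun w hw => by_contra fun hn => ?_, hE⟩
      exact hw.2 (by rw [← hf w, hE w hw _ hn (hadj w)]; exact hfc)
    · have hE : ∀ a ∈ A, ∀ b ∉ A, G.Adj a b → b = c := fun a ha b hb hab =>
        by_contra fun hbc => hcut a ha b hbc hb hab
      refine ⟨A, hAne, fun h => hA h rfl,
        even_ncard_of_involution hf hne fun w hw => by_contra fun hn => ?_, hE⟩
      exact hfc (by rw [← hE w hw _ hn (hadj w), hf]; exact hw)
  refine ⟨Eᶜ, hcE, fun h => ?_, ?_, fun a ha b _ hb hab => ?_⟩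
  · obtain ⟨x, hx⟩ := hEne
    exact (h ▸ Set.mem_univ x : x ∈ Eᶜ) hx
  · have h1 : Even (Set.univ : Set V).ncard := even_ncard_of_involution hf hne fun _ _ => trivial
    rw [Set.ncard_univ, ← Set.ncard_add_ncard_compl E, Nat.even_add] at h1
    exact h1.1 hEev
  · exact hE b (by_contra hb) a ha hab.symm

theorem Robust.family_of_noCutVertex [Finite V] (hG : Robust G) (hcon : G.Connected)
    (hcut : NoCutVertex G) : Family G := by
  obtain ⟨f, hf, hadj⟩ := hG G le_rfl hcon
  have hev : Even (Set.univ : Set V).ncard :=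
    even_ncard_of_involution hf (fun w => (hadj w).ne') fun _ _ => trivial
  rw [Set.ncard_univ] at hev
  by_cases h2 : ∀ v, ∃ x y, x ≠ y ∧ G.Adj v x ∧ G.Adj v y
  · obtain ⟨n, hn, ⟨e⟩⟩ := exists_cycleGraph_iso hcon h2 fun v x y z hx hy hz => by
      by_contra! h
      exact hG.not_three_neighbors hcut hx hy hz h.1 h.2.1 h.2.2
    rw [Nat.card_congr e.toEquiv, Nat.card_fin] at hev
    obtain ⟨k, rfl⟩ := even_iff_exists_two_mul.1 hev
    exact .evenCycle G k (by omega) e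
  · push Not at h2
    obtain ⟨v, hv⟩ := h2
    have huniv : (Set.univ : Set V) = {v, f v} := by
      ext w
      simp only [Set.mem_univ, true_iff, Set.mem_insert_iff, Set.mem_singleton_iff]
      by_contra! hw
      obtain ⟨a, ha, b, hb, -, hab⟩ := hcut (f v) w hw.2 {v}
        (by simpa using (hadj v).ne') ⟨v, rfl⟩ hw.1
      have ha : a = v := ha
      subst ha
      exact hv b (f a) hb hab (hadj a)
    have hcard : Nat.card V = 2 := by
      rw [← Set.ncard_univ, huniv, Set.ncard_pair (hadj v).ne]
    refine .K2 G ⟨Finite.equivFinOfCardEq hcard, fun {a b} => ?_⟩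
    have ha : a ∈ ({v, f v} : Set V) := huniv ▸ Set.mem_univ a
    have hb : b ∈ ({v, f v} : Set V) := huniv ▸ Set.mem_univ b
    have h1 := hadj v
    have h2 := h1.ne
    rcases ha with rfl | rfl <;> rcases hb with rfl | rfl <;> simp [h1, h1.symm, h2, h2.symm]

theorem Robust.family {V : Type u} [Finite V] {G : SimpleGraph V} (hG : Robust G)
    (hcon : G.Connected) : Family G := by
  induction hn : Nat.card V using Nat.strong_induction_on generalizing V with
  | _ n ih =>
    by_cases hcut : NoCutVertex G
    · exact hG.family_of_noCutVertex hcon hcut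
    unfold NoCutVertex at hcut
    push Not at hcut
    obtain ⟨c, r, hr, hcut⟩ := hcut
    obtain ⟨P, hcP, hPne, hPev, hProot⟩ :=
      (hG G le_rfl hcon).exists_even_of_not_linkedTo hr hcut
    have hP : RootMap G P fun _ => c :=
      ⟨fun _ _ => hcP, fun _ _ => rfl, fun _ _ => by simpa using hPev, fun z hz w hzw =>
        or_iff_not_imp_left.2 fun h =>
          (hProot z hz w trivial (fun hw => h ⟨hw, rfl⟩) hzw).symm⟩
    obtain ⟨ρ, hρ, hρP, hρP'⟩ := hP.exists_univ hG hcon hcP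
      (((connected_iff_linkedTo c).1 hcon).restrict (Set.subset_univ _) hProot)
    -- A vertex outside `P` has its root outside `P`, so there are at least two parts and each is
    -- smaller than `V`.
    obtain ⟨y, hy⟩ := (Set.ne_univ_iff_exists_notMem P).1 hPne
    have hρc : ρ c = c := hρP c hcP
    have hρy : ρ y ≠ c := fun h => hρP' y hy (h ▸ hcP)
    have hnt : Nontrivial {r | ρ r = r} :=
      ⟨⟨c, hρc⟩, ⟨ρ y, hρ.idem y trivial⟩, fun h => hρy (congrArg Subtype.val h).symm⟩
    refine .identify G (G.induce {r | ρ r = r}) (hρ.connected_roots hcon) _ (fun i => ?_) _ hρ.iso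
    obtain ⟨i, hi⟩ := i
    have hi : ρ i = i := hi
    have hroot : RootedIn G Set.univ {w | ρ w = i} i := fun a ha b _ hb hab => by
      have ha : ρ a = i := ha
      exact ((hρ.rooted a trivial b hab).resolve_left fun h => hb (h.2.trans ha)).symm.trans ha
    have hev : Even {w | ρ w = i}.ncard := by simpa [hi] using hρ.even i trivial
    refine ih _ ?_ (hG.induce hcon (r := i) hi hev hroot)
      ((((connected_iff_linkedTo i).1 hcon).restrict (Set.subset_univ _) hroot).connected_induce hi)
      rfl
    rw [← hn, ← Set.ncard_univ V, Nat.card_coe_set_eq]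
    refine Set.ncard_lt_ncard (Set.ssubset_univ_iff.2 fun h => hρy ?_)
    have h1 : c ∈ {w | ρ w = i} := h ▸ Set.mem_univ c
    have h2 : y ∈ {w | ρ w = i} := h ▸ Set.mem_univ y
    exact (show ρ y = i from h2).trans ((show ρ c = i from h1).symm.trans hρc)

end FamilyOfRobust

end AntiKekule

/-! ### The equivalences. -/

theorem theorem1p1 {V : Type*} [Finite V] (G : SimpleGraph V) (hG : G.Connected) :
    List.TFAE [
      ¬ ∃ S : Set (Sym2 V), AntiKekule.IsAntiKekuleSet G S,
      ∀ G' : SimpleGraph V, G' ≤ G → G'.Connected → AntiKekule.HasPerfectMatching G',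
      ∀ T : SimpleGraph V, T ≤ G → T.IsTree → AntiKekule.HasPerfectMatching T,
      AntiKekule.Family G] := by
  have hrobust : AntiKekule.Robust G ↔
      ∀ G' : SimpleGraph V, G' ≤ G → G'.Connected → AntiKekule.HasPerfectMatching G' := by
    simp only [AntiKekule.hasPerfectMatching_iff_matchable, AntiKekule.Robust]
  tfae_have 1 → 2 := by
    intro h G' hle hcon
    by_contra hn
    refine h ⟨G.edgeSet \ G'.edgeSet, Set.sdiff_subset, ?_⟩
    rw [SimpleGraph.deleteEdges_sdiff_eq_of_le hle]
    exact ⟨hcon, hn⟩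
  tfae_have 2 → 1 := by
    rintro h ⟨S, -, hcon, hn⟩
    exact hn (h _ (G.deleteEdges_le S) hcon)
  tfae_have 2 → 3 := fun h T hle hT => h T hle hT.connected
  tfae_have 3 → 2 := by
    intro h G' hle hcon
    obtain ⟨T, hT, htree⟩ := hcon.exists_isTree_le
    have hM := h T (hT.trans hle) htree
    rw [AntiKekule.hasPerfectMatching_iff_matchable] at hM ⊢
    obtain ⟨f, hf, hadj⟩ := hM
    exact ⟨f, hf, fun w => hT (hadj w)⟩
  tfae_have 2 → 4 := fun h => (hrobust.2 h).family hG
  tfae_have 4 → 2 := fun h => hrobust.1 h.robust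
  tfae_finish
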